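/- Let $\mathcal M=(E,\mathcal I)$ be a matroid on a finite ground set $E$ with $n=|E|$ and rank function $\mathrm{rk}$, and write $\overline A=E\setminus A$. Define the fractional packing and covering numbers $$\Phi_{\mathcal M}=\min_{A\subseteq E,\ \mathrm{rk}(\overline A)<\mathrm{rk}(E)}\frac{|A|}{\mathrm{rk}(E)-\mathrm{rk}(\overline A)},\qquad \beta_{\mathcal M}=\max_{\emptyset\neq A\subseteq E}\frac{|A|}{\mathrm{rk}(A)},$$ with the conventions $\Phi_{\mathcal M}=\infty$ if $\mathrm{rk}(E)=0$ and $|A|/\mathrm{rk}(A)=\infty$ if $A\ne\emptyset$ and $\mathrm{rk}(A)=0$ (so $\beta_{\mathcal M}=\infty$ if $\mathcal M$ has a loop). Put $\Phi=\Phi_{\mathcal M}$ and $\beta=\beta_{\mathcal M}$. The ideal relative loads $\ell^*(e)$, $e\in E$, are assigned recursively: choose $A_0\subseteq E$ with $\mathrm{rk}(\overline{A_0})<\mathrm{rk}(E)$ and $|A_0|/(\mathrm{rk}(E)-\mathrm{rk}(\overline{A_0}))=\Phi_{\mathcal M}$, set $\ell^*(e)=1/\Phi_{\mathcal M}$ for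 all $e\in A_0$, and recurse on the restricted matroid $\mathcal M|\overline{A_0}$; if the rank is $0$, set $\ell^*(e)=0$ for all remaining elements (they are loops of $\mathcal M$). The choices of $A_0$ are arbitrary. A greedy base collection is a finite nonempty sequence $\mathcal B=(B_1,\dots,B_t)$ of bases of $\mathcal M$ such that, for each $i$, $B_i$ is a base of minimum total weight with respect to the weights $e\mapsto|\{j<i: e\in B_j\}|$, ties being broken arbitrarily. Its size is $|\mathcal B|=t$, and the relative load of $e$ is $\ell^{\mathcal B}(e)=|\{j: e\in B_j\}|/t$. **Lemma.** Let $0<\varepsilon<1$, let $\gamma$ be a real number with $\Phi\le\gamma\le\beta$, and let $\mathcal B$ be a greedy base collection with $|\mathcal B|\ge 3\gamma\log n/\varepsilon^2$, where $\log$ is the natural logarithm. Then $$|\ell^{\mathcal B}(e)-\ell^*(e)|\le\varepsilon\,\ell^*(e)\quad\text{for all } e\in E \text{ with } \ell^*(e)\ge 1/\gamma,$$ and $$|\ell^{\mathcal B}(e)-\ell^*(e)|\le\varepsilon/\gamma\quad\text{for all } e\in E \text{ with } \ell^*(e)\le 1/\gamma.$$ -/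

import Mathlib

open scoped ENNReal

noncomputable section

namespace BaseCollection

variable {α : Type*}

/-- The ratio `|A| / (rk(E) - rk(E \ A))`. -/
def packingRatio (M : Matroid α) (A : Set α) : ℝ≥0∞ :=
  (A.encard : ℝ≥0∞) / ((M.eRk M.E : ℝ≥0∞) - (M.eRk (M.E \ A) : ℝ≥0∞))

/-- The fractional packing number `Φ`: the minimum of `|A| / (rk(E) - rk(E \ A))` over the sets
`A ⊆ E` with `rk(E \ A) < rk(E)`. It is `∞` (a minimum over no set) if and only if the matroid
has rank zero. -/
def packingNumber (M : Matroid α) : ℝ≥0∞ :=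
  ⨅ (A : Set α) (_ : A ⊆ M.E) (_ : M.eRk (M.E \ A) < M.eRk M.E), packingRatio M A

/-- The fractional covering number `β`: the maximum of `|A| / rk(A)` over the nonempty sets
`A ⊆ E`. It is `∞` if the matroid has a loop (a singleton of rank zero). -/
def coveringNumber (M : Matroid α) : ℝ≥0∞ :=
  ⨆ (A : Set α) (_ : A ⊆ M.E) (_ : A.Nonempty), (A.encard : ℝ≥0∞) / (M.eRk A : ℝ≥0∞)

/-- `IsIdealLoad M ℓ` says that `ℓ` is a possible outcome of the recursive assignment of ideal
relative loads to the elements of `M`: as long as the rank is positive, pick a set `A` at which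
the minimum defining `Φ` is attained, give the elements of `A` the value `1 / Φ`, and recurse on
the restriction of `M` to the complement of `A`. Elements left over when the rank is zero
(these are the loops of `M`) get the value `0`, that is, `1 / Φ` with `Φ = ∞`. -/
inductive IsIdealLoad : Matroid α → (α → ℝ) → Prop
  | rank_zero (M : Matroid α) (ℓ : α → ℝ) (hM : M.eRk M.E = 0) (hℓ : ∀ e ∈ M.E, ℓ e = 0) :
      IsIdealLoad M ℓ
  | step (M : Matroid α) (ℓ : α → ℝ) (A : Set α) (hA : A ⊆ M.E)
      (hrk : M.eRk (M.E \ A) < M.eRk M.E) (hmin : packingRatio M A = packingNumber M)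
      (hℓ : ∀ e ∈ A, ℓ e = ((packingNumber M)⁻¹).toReal)
      (hrec : IsIdealLoad (M.restrict (M.E \ A)) ℓ) : IsIdealLoad M ℓ

/-- `B` is a base of `M` of minimum total weight. -/
def IsMinWeightBase (M : Matroid α) (w : α → ℕ) (B : Finset α) : Prop :=
  M.IsBase (B : Set α) ∧
    ∀ B' : Finset α, M.IsBase (B' : Set α) → ∑ e ∈ B, w e ≤ ∑ e ∈ B', w e

open Classical in
/-- The load of `e` in the collection `B 0, …, B (t - 1)`: the number of members containing `e`. -/
def load (B : ℕ → Finset α) (t : ℕ) (e : α) : ℕ :=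
  ((Finset.range t).filter (fun i => e ∈ B i)).card

/-- The relative load of `e` in the collection `B 0, …, B (t - 1)`. -/
def relLoad (B : ℕ → Finset α) (t : ℕ) (e : α) : ℝ :=
  (load B t e : ℝ) / (t : ℝ)

/-- `B 0, …, B (t - 1)` is a greedy base collection: each member is a minimum weight base with
respect to the loads of the members before it (ties broken arbitrarily). Only the first `t`
terms of the sequence matter. -/
def IsGreedyBaseCollection (M : Matroid α) (B : ℕ → Finset α) (t : ℕ) : Prop :=
  ∀ i < t, IsMinWeightBase M (load B i) (B i)

/-- On a finite ground set the recursive assignment can always be carried out. -/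
theorem exists_isIdealLoad (M : Matroid α) [M.Finite] : ∃ ℓ : α → ℝ, IsIdealLoad M ℓ := by
  classical
  obtain ⟨n, hn⟩ : ∃ n, M.E.ncard = n := ⟨_, rfl⟩
  induction n using Nat.strong_induction_on generalizing M with
  | _ n ih =>
    by_cases h0 : M.eRk M.E = 0
    · exact ⟨fun _ => 0, .rank_zero M _ h0 fun _ _ => rfl⟩
    set S : Set (Set α) := {A | A ⊆ M.E ∧ M.eRk (M.E \ A) < M.eRk M.E} with hS
    have hfin : S.Finite := M.ground_finite.finite_subsets.subset fun A hA => hA.1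
    have hne : S.Nonempty := ⟨M.E, subset_rfl, by simpa using pos_iff_ne_zero.2 h0⟩
    obtain ⟨A, hA, hmin⟩ := hfin.exists_minimalFor (packingRatio M) S hne
    have hAle : ∀ A' ∈ S, packingRatio M A ≤ packingRatio M A' := fun A' hA' =>
      (le_total (packingRatio M A) (packingRatio M A')).elim id fun h => hmin hA' h
    have hval : packingRatio M A = packingNumber M := by
      refine le_antisymm (le_iInf fun A' => le_iInf fun h1 => le_iInf fun h2 => hAle A' ⟨h1, h2⟩) ?_
      exact (iInf_le _ A).trans ((iInf_le _ hA.1).trans (iInf_le _ hA.2))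
    have hAne : A.Nonempty := by
      rw [Set.nonempty_iff_ne_empty]
      rintro rfl
      simpa using hA.2
    have hlt : (M.E \ A).ncard < n := by
      rw [← hn]
      obtain ⟨a, ha⟩ := hAne
      exact Set.ncard_lt_ncard ⟨Set.sdiff_subset, fun h => (h (hA.1 ha)).2 ha⟩ M.ground_finite
    have : (M.restrict (M.E \ A)).Finite := ⟨M.ground_finite.subset Set.sdiff_subset⟩
    obtain ⟨ℓ, hℓ⟩ := ih _ hlt (M.restrict (M.E \ A)) rfl
    refine ⟨fun e => if e ∈ A then ((packingNumber M)⁻¹).toReal else ℓ e,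
      .step M _ A hA.1 hA.2 hval (fun e he => by simp [he]) ?_⟩
    have congr : ∀ (N : Matroid α) (f : α → ℝ), IsIdealLoad N f →
        ∀ g : α → ℝ, (∀ e ∈ N.E, g e = f e) → IsIdealLoad N g := by
      intro N f hf
      induction hf with
      | rank_zero N f hN hf =>
        exact fun g hg => .rank_zero N g hN fun e he => (hg e he).trans (hf e he)
      | step N f C hC hrk hm hf _ ihr =>
        exact fun g hg => .step N g C hC hrk hm (fun e he => (hg e (hC he)).trans (hf e he))
          (ihr g fun e he => hg e he.1)
    exact congr _ ℓ hℓ _ fun e he => by simp [show e ∉ A from he.2]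

end BaseCollection

end

/-!
The order in which a greedy base collection treats the elements depends only on the order of their
loads, so each base `B` of the collection is also of minimum weight for every nondecreasing, and of
maximum weight for every nonincreasing, function of the loads. This makes the exponential potentials
`∑ (1 + ε) ^ load` and `∑ (1 - ε) ^ load` available.

The ideal loads `ℓ` enter through two facts: `ℓ(X) ≤ rk(X)` for every set `X`
(`IsIdealLoad.sum_le_realRk`), with equality on the lower level sets `{ℓ ≤ c}` and `{ℓ < c}`
(`IsIdealLoad.realRk_le_sum`). On the other side, a minimum weight base contains a basis of every
lower level set of the weights (`IsMinWeightBase.card_filter_eq_realRk`). By submodularity of the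
rank and summation by layers, for a tight set `L` the part `B ∩ L` weighs at most what `ℓ` weighs
on `L` for nondecreasing functions of the loads (`IsMinWeightBase.sum_le_of_tight`), and `B \ L`
weighs at least what `ℓ` weighs off `L` for nonincreasing ones (`IsMinWeightBase.le_sum_of_tight`).

Fix an element `e`. On `{ℓ ≤ ℓ e}` the first potential grows by a factor of at most `1 + ε ℓ(e)` per
step, and on `{ℓ ≥ ℓ e}` the second one is multiplied by at most `1 - ε ℓ(e)`. Both start at no more
than `n`, so taking logarithms after `t` steps gives
`load(e) log (1 + ε) ≤ log n + ε t ℓ(e)` and `-load(e) log (1 - ε) ≥ ε t ℓ(e) - log n`.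
With `log n ≤ ε² t / (3 γ)`, the Chernoff-type estimates `(1 + ε) log (1 + ε) ≥ ε + ε² / 3` and
`-(1 - ε) log (1 - ε) ≤ ε - ε² / 2` turn these into `|load(e) / t - ℓ(e)| ≤ ε max (ℓ(e), 1 / γ)`.
-/

open scoped ENNReal

namespace BaseCollection

variable {α : Type*}

/-! ### Real-valued rank -/

/-- The rank of a set as a real number; a set of infinite rank gets the junk value `0`. -/
noncomputable def realRk (M : Matroid α) (X : Set α) : ℝ := ((M.eRk X).toNat : ℝ)

lemma coe_toNat_eRk (M : Matroid α) [M.Finite] (X : Set α) :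
    ((M.eRk X).toNat : ℕ∞) = M.eRk X :=
  ENat.natCast_toNat (Matroid.eRk_ne_top_iff.2 (M.isRkFinite_set X))

lemma realRk_mono (M : Matroid α) [M.Finite] {X Y : Set α} (h : X ⊆ Y) :
    realRk M X ≤ realRk M Y := by
  have := M.eRk_mono h
  rw [← coe_toNat_eRk M X, ← coe_toNat_eRk M Y] at this
  unfold realRk
  exact_mod_cast this

lemma realRk_submod (M : Matroid α) [M.Finite] (X Y : Set α) :
    realRk M (X ∩ Y) + realRk M (X ∪ Y) ≤ realRk M X + realRk M Y := by
  have := M.eRk_inter_add_eRk_union_le X Y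
  rw [← coe_toNat_eRk M (X ∩ Y), ← coe_toNat_eRk M (X ∪ Y), ← coe_toNat_eRk M X,
    ← coe_toNat_eRk M Y] at this
  unfold realRk
  exact_mod_cast this

lemma realRk_union_sub_le (M : Matroid α) [M.Finite] (X Y : Set α) :
    realRk M (X ∪ Y) - realRk M Y ≤ realRk M X - realRk M (X ∩ Y) := by
  linarith [realRk_submod M X Y]

lemma realRk_restrict (M : Matroid α) {R X : Set α} (h : X ⊆ R) :
    realRk (M.restrict R) X = realRk M X := by
  rw [realRk, M.restrict_eRk_eq h, realRk]

lemma realRk_nonneg (M : Matroid α) (X : Set α) : 0 ≤ realRk M X := Nat.cast_nonneg _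

lemma eRk_lt_iff_realRk_lt (M : Matroid α) [M.Finite] (X Y : Set α) :
    M.eRk X < M.eRk Y ↔ realRk M X < realRk M Y := by
  rw [← coe_toNat_eRk M X, ← coe_toNat_eRk M Y, realRk, realRk, Nat.cast_lt, Nat.cast_lt]

lemma card_le_realRk (M : Matroid α) [M.Finite] {I : Finset α} {X : Set α}
    (hI : M.Indep I) (hX : (I : Set α) ⊆ X) : (I.card : ℝ) ≤ realRk M X := by
  have := hI.encard_le_eRk_of_subset hX
  rw [← coe_toNat_eRk M X, Set.encard_coe_eq_coe_finsetCard] at this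
  unfold realRk
  exact_mod_cast this

lemma realRk_eq_card (M : Matroid α) {I : Finset α} {X : Set α}
    (hI : M.IsBasis I X) : realRk M X = I.card := by
  rw [realRk, ← hI.encard_eq_eRk, Set.encard_coe_eq_coe_finsetCard]
  simp

/-! ### Ideal loads and the rank function -/

lemma packingRatio_eq_ofReal (M : Matroid α) [M.Finite] {A : Set α} (hA : A ⊆ M.E)
    (h : M.eRk (M.E \ A) < M.eRk M.E) :
    packingRatio M A =
      ENNReal.ofReal ((A.ncard : ℝ) / (realRk M M.E - realRk M (M.E \ A))) := by
  have hlt := (eRk_lt_iff_realRk_lt M _ _).1 h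
  have hfin : A.Finite := M.ground_finite.subset hA
  rw [packingRatio, ENNReal.ofReal_div_of_pos (sub_pos.2 hlt),
    ENNReal.ofReal_sub _ (realRk_nonneg _ _), realRk, realRk, ENNReal.ofReal_natCast,
    ENNReal.ofReal_natCast, ENNReal.ofReal_natCast, ← coe_toNat_eRk M M.E,
    ← coe_toNat_eRk M (M.E \ A), ← hfin.cast_ncard_eq]
  simp

lemma nonempty_of_eRk_diff_lt {M : Matroid α} {A : Set α}
    (h : M.eRk (M.E \ A) < M.eRk M.E) : A.Nonempty := by
  rw [Set.nonempty_iff_ne_empty]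
  rintro rfl
  simp at h

/-- Let `φ = 1 / Φ`. If `A` attains the minimum defining `Φ`, then deleting `A` lowers the rank by
exactly `φ |A|`. -/
lemma inv_packingNumber_mul_ncard {M : Matroid α} [M.Finite] {A : Set α} (hA : A ⊆ M.E)
    (h : M.eRk (M.E \ A) < M.eRk M.E) (hmin : packingRatio M A = packingNumber M) :
    ((packingNumber M)⁻¹).toReal * A.ncard = realRk M M.E - realRk M (M.E \ A) := by
  have hlt := (eRk_lt_iff_realRk_lt M _ _).1 h
  have hc : (0 : ℝ) < A.ncard := by
    exact_mod_cast (Set.ncard_pos (M.ground_finite.subset hA)).2 (nonempty_of_eRk_diff_lt h)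
  rw [← hmin, packingRatio_eq_ofReal M hA h, ENNReal.toReal_inv,
    ENNReal.toReal_ofReal (div_nonneg hc.le (sub_pos.2 hlt).le), inv_div]
  field_simp

/-- Let `φ = 1 / Φ`. If the minimum defining `Φ` is attained, then deleting any set `C` of elements
lowers the rank by at most `φ |C|`. -/
lemma realRk_sub_le_inv_packingNumber_mul {M : Matroid α} [M.Finite] {A : Set α} (hA : A ⊆ M.E)
    (h : M.eRk (M.E \ A) < M.eRk M.E) (hmin : packingRatio M A = packingNumber M)
    {C : Set α} (hC : C ⊆ M.E) :
    realRk M M.E - realRk M (M.E \ C) ≤ ((packingNumber M)⁻¹).toReal * C.ncard := by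
  by_cases hCr : M.eRk (M.E \ C) < M.eRk M.E
  · have hlt := (eRk_lt_iff_realRk_lt M _ _).1 h
    have hltC := (eRk_lt_iff_realRk_lt M _ _).1 hCr
    have hc : (0 : ℝ) < A.ncard := by
      exact_mod_cast (Set.ncard_pos (M.ground_finite.subset hA)).2 (nonempty_of_eRk_diff_lt h)
    have hle : packingRatio M A ≤ packingRatio M C := by
      rw [hmin]
      exact (iInf_le _ C).trans ((iInf_le _ hC).trans (iInf_le _ hCr))
    rw [packingRatio_eq_ofReal M hA h, packingRatio_eq_ofReal M hC hCr,
      ENNReal.ofReal_le_ofReal_iff (div_nonneg (Nat.cast_nonneg _) (sub_pos.2 hltC).le),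
      div_le_div_iff₀ (sub_pos.2 hlt) (sub_pos.2 hltC),
      ← inv_packingNumber_mul_ncard hA h hmin] at hle
    refine le_of_mul_le_mul_left ?_ hc
    linarith
  · rw [eRk_lt_iff_realRk_lt, not_lt] at hCr
    have : (0 : ℝ) ≤ ((packingNumber M)⁻¹).toReal * C.ncard := by positivity
    linarith

/-- This expresses the monotonicity of the recursion: if deleting any set `C` lowers
the rank of `M` by at most `φ |C|`, then no ideal load of `M` exceeds `φ`. -/
lemma IsIdealLoad.le_of_forall_realRk_sub_le {M : Matroid α} {ℓ : α → ℝ} (hℓ : IsIdealLoad M ℓ)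
    [M.Finite] {φ : ℝ} (hφ : 0 ≤ φ)
    (h : ∀ C ⊆ M.E, realRk M M.E - realRk M (M.E \ C) ≤ φ * C.ncard) :
    ∀ e ∈ M.E, ℓ e ≤ φ := by
  rename_i hMf
  revert hMf φ
  induction hℓ with
  | rank_zero M ℓ hM hℓ =>
    intro _ φ hφ _ e he
    exact (hℓ e he).trans_le hφ
  | step M ℓ A hA hrk hmin hℓ _ ih =>
    intro _ φ hφ h e he
    have : (M.restrict (M.E \ A)).Finite := ⟨M.ground_finite.subset Set.sdiff_subset⟩
    have hAeq := inv_packingNumber_mul_ncard hA hrk hmin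
    have hc : (0 : ℝ) < A.ncard := by
      exact_mod_cast (Set.ncard_pos (M.ground_finite.subset hA)).2 (nonempty_of_eRk_diff_lt hrk)
    have hle : ((packingNumber M)⁻¹).toReal ≤ φ :=
      le_of_mul_le_mul_right (hAeq.trans_le (h A hA)) hc
    by_cases heA : e ∈ A
    · exact (hℓ e heA).trans_le hle
    refine (ih ENNReal.toReal_nonneg (fun C hC => ?_) e ⟨he, heA⟩).trans hle
    simp only [Matroid.restrict_ground_eq] at hC ⊢
    rw [realRk_restrict M subset_rfl, realRk_restrict M Set.sdiff_subset]
    have hAC := realRk_sub_le_inv_packingNumber_mul hA hrk hmin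
      (Set.union_subset hA (hC.trans Set.sdiff_subset))
    have hdisj : Disjoint A C := Set.disjoint_left.2 fun x hxA hxC => (hC hxC).2 hxA
    rw [Set.ncard_union_eq hdisj (M.ground_finite.subset hA)
      (M.ground_finite.subset (hC.trans Set.sdiff_subset)), ← Set.sdiff_sdiff] at hAC
    push_cast at hAC
    linarith

/-- Ideal loads are nonnegative. -/
lemma IsIdealLoad.nonneg {M : Matroid α} {ℓ : α → ℝ} (hℓ : IsIdealLoad M ℓ) :
    ∀ e ∈ M.E, 0 ≤ ℓ e := by
  induction hℓ with
  | rank_zero M ℓ hM hℓ => exact fun e he => (hℓ e he).ge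
  | step M ℓ A hA hrk hmin hℓ _ ih =>
    intro e he
    by_cases heA : e ∈ A
    · exact ENNReal.toReal_nonneg.trans_eq (hℓ e heA).symm
    · exact ih e ⟨he, heA⟩

/-- Ideal loads lie in the independent set polytope. For the first set `A` of the recursion the
inequality `|X ∩ A| / Φ ≤ rk(X) - rk(X \ A)` holds because `A \ X` cannot do better than `A`. -/
lemma IsIdealLoad.sum_le_realRk {M : Matroid α} {ℓ : α → ℝ} (hℓ : IsIdealLoad M ℓ) [M.Finite]
    (X : Finset α) (hX : (X : Set α) ⊆ M.E) : ∑ e ∈ X, ℓ e ≤ realRk M X := by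
  classical
  rename_i hMf
  revert hMf X
  induction hℓ with
  | rank_zero M ℓ hM hℓ =>
    intro _ X hX
    rw [Finset.sum_eq_zero fun e he => hℓ e (hX he)]
    exact realRk_nonneg _ _
  | step M ℓ A hA hrk hmin hℓ _ ih =>
    intro _ X hX
    have : (M.restrict (M.E \ A)).Finite := ⟨M.ground_finite.subset Set.sdiff_subset⟩
    have hsub : ((X.filter (· ∉ A) : Finset α) : Set α) ⊆ M.E \ A := by
      intro e he
      simp only [Finset.coe_filter, Set.mem_ofPred_eq] at he
      exact ⟨hX he.1, he.2⟩
    have h1 := ih (X.filter (· ∉ A)) hsub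
    rw [realRk_restrict M hsub] at h1
    have h2 : ∑ e ∈ X.filter (· ∈ A), ℓ e
        = ((packingNumber M)⁻¹).toReal * (X.filter (· ∈ A)).card := by
      rw [Finset.sum_congr rfl fun e he => hℓ e (Finset.mem_filter.1 he).2, Finset.sum_const,
        nsmul_eq_mul, mul_comm]
    rw [← Finset.sum_filter_add_sum_filter_not X (· ∈ A), h2]
    have hAeq := inv_packingNumber_mul_ncard hA hrk hmin
    have hAX := realRk_sub_le_inv_packingNumber_mul hA hrk hmin
      (C := A \ X) (Set.sdiff_subset.trans hA)
    have hcard : ((A \ X).ncard : ℝ) + (X.filter (· ∈ A)).card = A.ncard := by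
      rw [← Set.ncard_inter_add_ncard_sdiff_eq_ncard A X (M.ground_finite.subset hA),
        ← Set.ncard_coe_finset]
      rw [show ((X.filter (· ∈ A) : Finset α) : Set α) = A ∩ X by ext; simp [and_comm]]
      push_cast
      ring
    have hsm := realRk_union_sub_le M X (M.E \ A)
    rw [show M.E \ (A \ X) = ↑X ∪ (M.E \ A) by
      ext e
      have := @hX e
      simp only [Set.mem_sdiff, Set.mem_union] at *
      tauto] at hAX
    rw [show (X : Set α) ∩ (M.E \ A) = ((X.filter (· ∉ A) : Finset α) : Set α) by
      ext e
      have := @hX e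
      simp at *
      tauto] at hsm
    rw [← hcard] at hAeq
    linarith

/-- The lower level sets of an ideal load are tight for the rank function. The class of lower sets
`s` covers the two kinds of level sets needed, `{ℓ ≤ c}` and `{ℓ < c}`. -/
lemma IsIdealLoad.realRk_le_sum {M : Matroid α} {ℓ : α → ℝ} (hℓ : IsIdealLoad M ℓ) [M.Finite]
    {s : Set ℝ} (hs : IsLowerSet s) (X : Finset α) (hX : (X : Set α) = {e ∈ M.E | ℓ e ∈ s}) :
    realRk M X ≤ ∑ e ∈ X, ℓ e := by
  classical
  rename_i hMf
  revert hMf s X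
  induction hℓ with
  | rank_zero M ℓ hM hℓ =>
    intro _ s hs X hX
    have hXE : (X : Set α) ⊆ M.E := hX.trans_subset (Set.sep_subset _ _)
    rw [Finset.sum_eq_zero fun e he => hℓ e (hXE he)]
    refine (realRk_mono M hXE).trans ?_
    simp only [realRk, hM, ENat.toNat_zero, Nat.cast_zero, le_refl]
  | step M ℓ A hA hrk hmin hℓ hrec ih =>
    intro _ s hs X hX
    have : (M.restrict (M.E \ A)).Finite := ⟨M.ground_finite.subset Set.sdiff_subset⟩
    by_cases hmem : ((packingNumber M)⁻¹).toReal ∈ s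
    · -- The first value of the recursion is the largest, so the level set is all of `E`.
      have hXE : (X : Set α) = M.E := by
        rw [hX, Set.sep_eq_self_iff_mem_true]
        exact fun e he => hs ((IsIdealLoad.step M ℓ A hA hrk hmin hℓ
          hrec).le_of_forall_realRk_sub_le ENNReal.toReal_nonneg
          (fun C hC => realRk_sub_le_inv_packingNumber_mul hA hrk hmin hC) e he) hmem
      have hsub : ((X.filter (· ∉ A) : Finset α) : Set α) = M.E \ A := by
        ext e
        rw [← hXE]
        simp
      have h1 := ih isLowerSet_univ (X.filter (· ∉ A)) (by rw [hsub]; ext; simp)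
      rw [hsub, realRk_restrict M subset_rfl] at h1
      have hfA : ((X.filter (· ∈ A) : Finset α) : Set α) = A := by
        ext e
        have := @hA e
        rw [← hXE] at this
        simpa using this
      have h2 : ∑ e ∈ X.filter (· ∈ A), ℓ e = ((packingNumber M)⁻¹).toReal * A.ncard := by
        rw [Finset.sum_congr rfl fun e he => hℓ e (Finset.mem_filter.1 he).2, Finset.sum_const,
          nsmul_eq_mul, mul_comm, ← Set.ncard_coe_finset, hfA]
      rw [← Finset.sum_filter_add_sum_filter_not X (· ∈ A), h2,
        inv_packingNumber_mul_ncard hA hrk hmin, hXE]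
      linarith
    · have hXA : (X : Set α) = {e ∈ (M.restrict (M.E \ A)).E | ℓ e ∈ s} := by
        rw [hX]
        ext e
        simp only [Set.mem_ofPred_eq, Matroid.restrict_ground_eq, Set.mem_sdiff]
        have : e ∈ A → ℓ e ∉ s := fun he => by rwa [hℓ e he]
        tauto
      have h1 := ih hs X hXA
      rwa [realRk_restrict M (by
        rw [hXA]
        exact Set.sep_subset _ _)] at h1

/-! ### Minimum weight bases -/

open Classical in
/-- A minimum weight base contains a basis of every lower level set of the weights. -/
lemma IsMinWeightBase.card_filter_eq_realRk {M : Matroid α} [M.Finite] {w : α → ℕ} {B : Finset α}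
    (hB : IsMinWeightBase M w B) (c : ℕ) :
    ((B.filter (fun e => w e < c)).card : ℝ) = realRk M {e ∈ M.E | w e < c} := by
  refine (realRk_eq_card M ?_).symm
  have hind : M.Indep (B.filter (fun e => w e < c) : Finset α) :=
    hB.1.indep.subset (Finset.coe_subset.2 (Finset.filter_subset _ _))
  refine hind.isBasis_of_forall_insert ?_ ?_
  · intro e he
    simp only [Finset.coe_filter, Set.mem_ofPred_eq] at he
    exact ⟨hB.1.subset_ground he.1, he.2⟩
  rintro x ⟨⟨hxE, hxc⟩, hxB⟩
  have hxB' : x ∉ B := fun h => hxB (by simp [h, hxc])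
  rw [← Matroid.not_indep_iff (Set.insert_subset hxE hind.subset_ground)]
  intro hins
  -- Otherwise `x` can be exchanged for some `y ∈ B` with `w y ≥ c > w x`.
  obtain ⟨B', hB', hsub, hsup⟩ := hins.exists_isBase_subset_union_isBase hB.1
  have hdiff : B' \ B = {x} := by
    ext e
    have h1 := @hsup e
    have h2 := @hsub e
    simp only [Set.mem_insert_iff, Set.mem_union, Finset.coe_filter, Set.mem_ofPred_eq,
      Set.mem_sdiff, Finset.mem_coe, Set.mem_singleton_iff] at h1 h2 ⊢
    grind
  have hcard := hB'.encard_sdiff_comm hB.1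
  rw [hdiff, Set.encard_singleton, eq_comm, Set.encard_eq_one] at hcard
  obtain ⟨y, hy⟩ := hcard
  have hyB : y ∈ B ∧ y ∉ B' := by
    have : y ∈ (B : Set α) \ B' := by rw [hy]; rfl
    exact this
  have hyc : c ≤ w y := by
    by_contra! h
    exact hyB.2 (hsub (Set.mem_insert_of_mem _ (by simp [hyB.1, h])))
  have hbase : M.IsBase (insert x (B.erase y) : Finset α) := by
    convert hB' using 1
    ext e
    have h1 : e ∈ B' \ B ↔ e = x := by rw [hdiff]; rfl
    have h2 : e ∈ (B : Set α) \ B' ↔ e = y := by rw [hy]; rfl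
    simp only [Set.mem_sdiff, Finset.mem_coe] at h1 h2
    simp only [Finset.coe_insert, Finset.coe_erase, Set.mem_insert_iff, Set.mem_sdiff,
      Finset.mem_coe, Set.mem_singleton_iff]
    tauto
  have hle := hB.2 _ hbase
  rw [Finset.sum_insert (by simp [hxB']), ← Finset.add_sum_erase B w hyB.1] at hle
  omega

/-! ### Layer-cake summation -/

open Classical in
/-- Summation by layers for a nondecreasing function of the weights: it is enough to test the upper
level sets of the weights. -/
lemma sum_mul_nonneg_of_monotone (X : Finset α) (p : α → ℝ) (k : α → ℕ) {f : ℕ → ℝ}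
    (hf : Monotone f) (hf0 : 0 ≤ f 0)
    (hp : ∀ c, 0 ≤ ∑ e ∈ X.filter (fun e => c ≤ k e), p e) :
    0 ≤ ∑ e ∈ X, p e * f (k e) := by
  have key : ∀ N, 0 ≤ ∑ e ∈ X, p e * f (min (k e) N) := by
    intro N
    induction N with
    | zero =>
      have := hp 0
      simp only [zero_le, Finset.filter_true] at this
      simpa [← Finset.sum_mul] using mul_nonneg this hf0
    | succ N ih =>
      have hstep : ∑ e ∈ X, p e * f (min (k e) (N + 1)) = ∑ e ∈ X, p e * f (min (k e) N)
          + (∑ e ∈ X.filter (fun e => N + 1 ≤ k e), p e) * (f (N + 1) - f N) := by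
        rw [Finset.sum_mul, Finset.sum_filter, ← Finset.sum_add_distrib]
        refine Finset.sum_congr rfl fun e _ => ?_
        split_ifs with h
        · rw [min_eq_right h, min_eq_right (by omega)]
          ring
        · rw [min_eq_left (by omega), min_eq_left (by omega), add_zero]
      rw [hstep]
      exact add_nonneg ih (mul_nonneg (hp _) (sub_nonneg.2 (hf N.le_succ)))
  convert key (X.sup k) using 3 with e he
  rw [min_eq_left (Finset.le_sup he)]

open Classical in
/-- Summation by layers for a nonincreasing function of the weights: it is enough to test the lower
level sets of the weights. -/
lemma sum_mul_nonneg_of_antitone (X : Finset α) (p : α → ℝ) (k : α → ℕ) {f : ℕ → ℝ}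
    (hf : Antitone f) (hf0 : ∀ i, 0 ≤ f i)
    (hp : ∀ c, 0 ≤ ∑ e ∈ X.filter (fun e => k e < c), p e) :
    0 ≤ ∑ e ∈ X, p e * f (k e) := by
  have key : ∀ N, 0 ≤ ∑ e ∈ X.filter (fun e => k e < N), p e * (f (k e) - f N) := by
    intro N
    induction N with
    | zero => simp
    | succ N ih =>
      have hstep : ∑ e ∈ X.filter (fun e => k e < N + 1), p e * (f (k e) - f (N + 1))
          = ∑ e ∈ X.filter (fun e => k e < N), p e * (f (k e) - f N)
          + (∑ e ∈ X.filter (fun e => k e < N + 1), p e) * (f N - f (N + 1)) := by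
        simp only [Finset.sum_mul, Finset.sum_filter]
        rw [← Finset.sum_add_distrib]
        refine Finset.sum_congr rfl fun e _ => ?_
        rcases lt_trichotomy (k e) N with h | h | h
        · rw [if_pos (by omega), if_pos h, if_pos (by omega)]
          ring
        · rw [if_pos (by omega), if_neg (by omega), if_pos (by omega), h]
          ring
        · rw [if_neg (by omega), if_neg (by omega), if_neg (by omega), zero_mul, add_zero]
      rw [hstep]
      exact add_nonneg ih (mul_nonneg (hp _) (sub_nonneg.2 (hf N.le_succ)))
  set N := X.sup k + 1
  have hX : X.filter (fun e => k e < N) = X :=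
    Finset.filter_true_of_mem fun e he => Nat.lt_succ_of_le (Finset.le_sup he)
  have h1 := key N
  have h2 := mul_nonneg (hp N) (hf0 N)
  rw [hX] at h1 h2
  rw [Finset.sum_mul] at h2
  refine (add_nonneg h1 h2).trans_eq ?_
  rw [← Finset.sum_add_distrib]
  exact Finset.sum_congr rfl fun e _ => by ring

/-! ### A minimum weight base against the ideal loads -/

open Classical in
lemma sum_indicator_eq_card_inter (X B : Finset α) :
    ∑ e ∈ X, (if e ∈ B then (1 : ℝ) else 0) = (B ∩ X).card := by
  rw [Finset.sum_boole, Finset.filter_mem_eq_inter, Finset.inter_comm]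

open Classical in
/-- On a tight set `L`, a minimum weight base `B` is at most as heavy as `ℓ`, for every
nondecreasing function of the weights. The layer-cake test on `{w ≥ c}` is the chain
`|B ∩ L \ S| ≤ rk(L ∪ S) - rk(S) ≤ rk(L) - rk(L ∩ S) ≤ ℓ(L \ S)` for `S = {w < c}`. -/
lemma IsMinWeightBase.sum_le_of_tight {M : Matroid α} [M.Finite] {w : α → ℕ} {B L : Finset α}
    {ℓ : α → ℝ} (hB : IsMinWeightBase M w B) (hLE : (L : Set α) ⊆ M.E)
    (hℓ : ∀ X : Finset α, (X : Set α) ⊆ M.E → ∑ e ∈ X, ℓ e ≤ realRk M X)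
    (hL : realRk M L ≤ ∑ e ∈ L, ℓ e) {f : ℕ → ℝ} (hf : Monotone f) (hf0 : 0 ≤ f 0) :
    ∑ e ∈ L, (if e ∈ B then (1 : ℝ) else 0) * f (w e) ≤ ∑ e ∈ L, ℓ e * f (w e) := by
  rw [← sub_nonneg, ← Finset.sum_sub_distrib]
  simp only [← sub_mul]
  refine sum_mul_nonneg_of_monotone L _ w hf hf0 fun c => ?_
  rw [Finset.sum_sub_distrib, sub_nonneg, sum_indicator_eq_card_inter]
  set S : Set α := {e ∈ M.E | w e < c}
  have hBS := hB.card_filter_eq_realRk c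
  have hun : ((B.filter (fun e => w e < c) ∪ B ∩ L.filter (fun e => c ≤ w e)).card : ℝ)
      ≤ realRk M (L ∪ S) := by
    refine card_le_realRk M (hB.1.indep.subset ?_) ?_
    · intro e
      simp
      tauto
    · intro e
      have := fun h => hB.1.subset_ground (a := e) h
      simp [S] at this ⊢
      tauto
  rw [Finset.card_union_of_disjoint (Finset.disjoint_left.2 fun e h1 h2 => by
    simp at h1 h2; omega)] at hun
  push_cast at hun
  have hsm := realRk_union_sub_le M (L : Set α) S
  have hLS := hℓ (L.filter (fun e => ¬ c ≤ w e))
    ((Finset.coe_subset.2 (Finset.filter_subset _ _)).trans hLE)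
  rw [show ((L.filter (fun e => ¬ c ≤ w e) : Finset α) : Set α) = ↑L ∩ S by
    ext e
    have := @hLE e
    simp [S] at this ⊢
    tauto] at hLS
  have hsplit := Finset.sum_filter_add_sum_filter_not L (fun e => c ≤ w e) ℓ
  linarith

open Classical in
/-- On the complement `U` of a tight set `L`, a minimum weight base `B` is at least as heavy as `ℓ`,
for every nonincreasing function of the weights. The layer-cake test on `S = {w < c}` is the chain
`ℓ(S \ L) ≤ rk(S ∪ L) - rk(L) ≤ rk(S) - rk(S ∩ L) ≤ |B ∩ S \ L|`. -/
lemma IsMinWeightBase.le_sum_of_tight {M : Matroid α} [M.Finite] {w : α → ℕ} {B L U : Finset α}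
    {ℓ : α → ℝ} (hB : IsMinWeightBase M w B) (hLU : (U : Set α) = M.E \ L)
    (hLE : (L : Set α) ⊆ M.E)
    (hℓ : ∀ X : Finset α, (X : Set α) ⊆ M.E → ∑ e ∈ X, ℓ e ≤ realRk M X)
    (hL : realRk M L ≤ ∑ e ∈ L, ℓ e) {f : ℕ → ℝ} (hf : Antitone f) (hf0 : ∀ i, 0 ≤ f i) :
    ∑ e ∈ U, ℓ e * f (w e) ≤ ∑ e ∈ U, (if e ∈ B then (1 : ℝ) else 0) * f (w e) := by
  rw [← sub_nonneg, ← Finset.sum_sub_distrib]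
  simp only [← sub_mul]
  refine sum_mul_nonneg_of_antitone U _ w hf hf0 fun c => ?_
  rw [Finset.sum_sub_distrib, sub_nonneg, sum_indicator_eq_card_inter]
  set S : Set α := {e ∈ M.E | w e < c}
  have hmem : ∀ e, e ∈ U ↔ e ∈ M.E ∧ e ∉ L := fun e => by
    rw [← Finset.mem_coe, hLU]; simp
  have hBS := hB.card_filter_eq_realRk c
  rw [← Finset.card_filter_add_card_filter_not (fun e => e ∈ L)] at hBS
  push_cast at hBS
  have hBSL : (((B.filter (fun e => w e < c)).filter (fun e => e ∈ L)).card : ℝ)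
      ≤ realRk M (S ∩ L) := by
    refine card_le_realRk M (hB.1.indep.subset ?_) ?_
    · intro e
      simp
      tauto
    · intro e
      have := fun h => hB.1.subset_ground (a := e) h
      simp [S] at this ⊢
      tauto
  have hBU : (B.filter (fun e => w e < c)).filter (fun e => ¬ e ∈ L)
      = B ∩ U.filter (fun e => w e < c) := by
    ext e
    have := fun h => hB.1.subset_ground (a := e) h
    have h2 := hmem e
    simp at this ⊢
    tauto
  rw [hBU] at hBS
  have hsm := realRk_union_sub_le M S (L : Set α)
  have hdisj : Disjoint (U.filter (fun e => w e < c)) L :=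
    Finset.disjoint_left.2 fun e h1 h2 => ((hmem e).1 (Finset.mem_filter.1 h1).1).2 h2
  have hLS := hℓ (U.filter (fun e => w e < c) ∪ L) (by
    intro e
    have := @hLE e
    have h2 := hmem e
    simp at this ⊢
    tauto)
  rw [Finset.sum_union hdisj, show ((U.filter (fun e => w e < c) ∪ L : Finset α) : Set α)
    = S ∪ ↑L by
    ext e
    have := @hLE e
    have h2 := hmem e
    simp [S] at this ⊢
    tauto] at hLS
  linarith

/-! ### Exponential potentials of a greedy collection -/

open Classical in
lemma load_succ (B : ℕ → Finset α) (t : ℕ) (e : α) :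
    load B (t + 1) e = load B t e + if e ∈ B t then 1 else 0 := by
  unfold load
  rw [Finset.range_add_one, Finset.filter_insert]
  split_ifs with h
  · rw [Finset.card_insert_of_notMem (by simp)]
  · rfl

open Classical in
lemma pow_load_succ (B : ℕ → Finset α) (t : ℕ) (e : α) (δ : ℝ) :
    (1 + δ) ^ load B (t + 1) e
      = (1 + δ) ^ load B t e + δ * ((if e ∈ B t then 1 else 0) * (1 + δ) ^ load B t e) := by
  rw [load_succ]
  split_ifs <;> ring

/-- If `ℓ ≤ lam` on a tight set `L`, the potential `∑ (1 + ε) ^ load` over `L` is multiplied by at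
most `1 + ε lam` per step. -/
lemma IsGreedyBaseCollection.sum_pow_load_le {M : Matroid α} [M.Finite] {B : ℕ → Finset α} {t : ℕ}
    (hB : IsGreedyBaseCollection M B t) {L : Finset α} {ℓ : α → ℝ} (hLE : (L : Set α) ⊆ M.E)
    (hℓ : ∀ X : Finset α, (X : Set α) ⊆ M.E → ∑ e ∈ X, ℓ e ≤ realRk M X)
    (hL : realRk M L ≤ ∑ e ∈ L, ℓ e) {ε lam : ℝ} (hε : 0 ≤ ε) (hlam : 0 ≤ lam)
    (hle : ∀ e ∈ L, ℓ e ≤ lam) :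
    ∑ e ∈ L, (1 + ε) ^ load B t e ≤ L.card * (1 + ε * lam) ^ t := by
  classical
  induction t with
  | zero => simp [load]
  | succ t ih =>
    have ih := ih fun i hi => hB i (by omega)
    have h1 := (hB t (by omega)).sum_le_of_tight hLE hℓ hL
      (f := fun i => (1 + ε) ^ i) (fun i j hij => pow_le_pow_right₀ (by linarith) hij) (by simp)
    have h2 : ∑ e ∈ L, ℓ e * (1 + ε) ^ load B t e ≤ lam * ∑ e ∈ L, (1 + ε) ^ load B t e := by
      rw [Finset.mul_sum]
      exact Finset.sum_le_sum fun e he => mul_le_mul_of_nonneg_right (hle e he) (by positivity)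
    simp only [pow_load_succ]
    rw [Finset.sum_add_distrib, ← Finset.mul_sum]
    calc _ ≤ (1 + ε * lam) * ∑ e ∈ L, (1 + ε) ^ load B t e := by
          nlinarith [mul_le_mul_of_nonneg_left (h1.trans h2) hε]
      _ ≤ (1 + ε * lam) * (L.card * (1 + ε * lam) ^ t) :=
          mul_le_mul_of_nonneg_left ih (by positivity)
      _ = _ := by ring

/-- If `ℓ ≥ lam` on the complement `U` of a tight set, the potential `∑ (1 - ε) ^ load` over `U` is
multiplied by at most `1 - ε lam ≤ exp (-ε lam)` per step. The exponential keeps the bound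
meaningful when `1 - ε lam` is negative. -/
lemma IsGreedyBaseCollection.sum_pow_load_le_exp {M : Matroid α} [M.Finite] {B : ℕ → Finset α}
    {t : ℕ} (hB : IsGreedyBaseCollection M B t) {L U : Finset α} {ℓ : α → ℝ}
    (hLU : (U : Set α) = M.E \ L) (hLE : (L : Set α) ⊆ M.E)
    (hℓ : ∀ X : Finset α, (X : Set α) ⊆ M.E → ∑ e ∈ X, ℓ e ≤ realRk M X)
    (hL : realRk M L ≤ ∑ e ∈ L, ℓ e) {ε lam : ℝ} (hε : 0 ≤ ε) (hε1 : ε ≤ 1)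
    (hle : ∀ e ∈ U, lam ≤ ℓ e) :
    ∑ e ∈ U, (1 - ε) ^ load B t e ≤ U.card * Real.exp (-(ε * lam)) ^ t := by
  classical
  induction t with
  | zero => simp [load]
  | succ t ih =>
    have ih := ih fun i hi => hB i (by omega)
    have h1 := (hB t (by omega)).le_sum_of_tight hLU hLE hℓ hL
      (f := fun i => (1 - ε) ^ i)
      (fun i j hij => pow_le_pow_of_le_one (by linarith) (by linarith) hij)
      (fun i => pow_nonneg (by linarith) i)
    have hpos : ∀ e, 0 ≤ (1 - ε) ^ load B t e := fun e => pow_nonneg (by linarith) _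
    have h2 : lam * ∑ e ∈ U, (1 - ε) ^ load B t e ≤ ∑ e ∈ U, ℓ e * (1 - ε) ^ load B t e := by
      rw [Finset.mul_sum]
      exact Finset.sum_le_sum fun e he => mul_le_mul_of_nonneg_right (hle e he) (hpos e)
    have hexp : 1 - ε * lam ≤ Real.exp (-(ε * lam)) := by
      linarith [Real.add_one_le_exp (-(ε * lam))]
    simp only [sub_eq_add_neg 1 ε, pow_load_succ] at *
    rw [Finset.sum_add_distrib, ← Finset.mul_sum]
    calc _ ≤ (1 - ε * lam) * ∑ e ∈ U, (1 + -ε) ^ load B t e := by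
          nlinarith [mul_le_mul_of_nonneg_left (h2.trans h1) hε]
      _ ≤ Real.exp (-(ε * lam)) * ∑ e ∈ U, (1 + -ε) ^ load B t e :=
          mul_le_mul_of_nonneg_right hexp (Finset.sum_nonneg fun e _ => hpos e)
      _ ≤ Real.exp (-(ε * lam)) * (U.card * Real.exp (-(ε * lam)) ^ t) :=
          mul_le_mul_of_nonneg_left ih (Real.exp_pos _).le
      _ = _ := by ring

/-- The upper potential bound on the tight set `{ℓ ≤ ℓ e}`. -/
lemma IsIdealLoad.load_mul_log_le {M : Matroid α} [M.Finite] {ℓ : α → ℝ} (hℓ : IsIdealLoad M ℓ)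
    {B : ℕ → Finset α} {t : ℕ} (hB : IsGreedyBaseCollection M B t) {ε : ℝ} (hε : 0 < ε)
    {e : α} (he : e ∈ M.E) :
    load B t e * Real.log (1 + ε) ≤ Real.log M.E.ncard + ε * ℓ e * t := by
  classical
  set G := M.ground_finite.toFinset
  set L := G.filter (fun x => ℓ x ≤ ℓ e)
  have hLset : (L : Set α) = {x ∈ M.E | ℓ x ∈ Set.Iic (ℓ e)} := by ext; simp [L, G]
  have hLE : (L : Set α) ⊆ M.E := hLset.trans_subset (Set.sep_subset _ _)
  have heL : e ∈ L := by simp [L, G, he]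
  have hpot := hB.sum_pow_load_le hLE (fun X hX => hℓ.sum_le_realRk X hX)
    (hℓ.realRk_le_sum (isLowerSet_Iic _) L hLset) hε.le (hℓ.nonneg e he)
    (fun x hx => (Finset.mem_filter.1 hx).2)
  have hcard : (L.card : ℝ) ≤ M.E.ncard := by
    rw [Set.ncard_eq_toFinset_card M.E M.ground_finite]
    exact_mod_cast Finset.card_filter_le _ _
  have hn : (0 : ℝ) < M.E.ncard := by
    exact_mod_cast (Set.ncard_pos M.ground_finite).2 ⟨e, he⟩
  have hmain : (1 + ε) ^ load B t e ≤ M.E.ncard * Real.exp (ε * ℓ e) ^ t := by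
    refine (Finset.single_le_sum (f := fun x => (1 + ε) ^ load B t x)
      (fun _ _ => by positivity) heL).trans (hpot.trans ?_)
    have := hℓ.nonneg e he
    gcongr
    linarith [Real.add_one_le_exp (ε * ℓ e)]
  have := Real.log_le_log (by positivity) hmain
  rw [Real.log_pow, Real.log_mul hn.ne' (by positivity), Real.log_pow, Real.log_exp] at this
  linarith

/-- The lower potential bound on `{ℓ ≥ ℓ e}`, the complement of the tight set `{ℓ < ℓ e}`. -/
lemma IsIdealLoad.le_load_mul_neg_log {M : Matroid α} [M.Finite] {ℓ : α → ℝ}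
    (hℓ : IsIdealLoad M ℓ) {B : ℕ → Finset α} {t : ℕ} (hB : IsGreedyBaseCollection M B t)
    {ε : ℝ} (hε : 0 < ε) (hε1 : ε < 1) {e : α} (he : e ∈ M.E) :
    ε * ℓ e * t - Real.log M.E.ncard ≤ load B t e * -Real.log (1 - ε) := by
  classical
  set G := M.ground_finite.toFinset
  set L := G.filter (fun x => ℓ x < ℓ e)
  set U := G.filter (fun x => ℓ e ≤ ℓ x)
  have hLset : (L : Set α) = {x ∈ M.E | ℓ x ∈ Set.Iio (ℓ e)} := by ext; simp [L, G]
  have hLE : (L : Set α) ⊆ M.E := hLset.trans_subset (Set.sep_subset _ _)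
  have hLU : (U : Set α) = M.E \ L := by
    ext x
    simp [L, U, G]
  have heU : e ∈ U := by simp [U, G, he]
  have hpot := hB.sum_pow_load_le_exp hLU hLE (fun X hX => hℓ.sum_le_realRk X hX)
    (hℓ.realRk_le_sum (isLowerSet_Iio _) L hLset) hε.le hε1.le
    (fun x hx => (Finset.mem_filter.1 hx).2)
  have hcard : (U.card : ℝ) ≤ M.E.ncard := by
    rw [Set.ncard_eq_toFinset_card M.E M.ground_finite]
    exact_mod_cast Finset.card_filter_le _ _
  have hn : (0 : ℝ) < M.E.ncard := by
    exact_mod_cast (Set.ncard_pos M.ground_finite).2 ⟨e, he⟩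
  have hε' : 0 < 1 - ε := by linarith
  have hmain : (1 - ε) ^ load B t e ≤ M.E.ncard * Real.exp (-(ε * ℓ e)) ^ t := by
    refine (Finset.single_le_sum (f := fun x => (1 - ε) ^ load B t x)
      (fun _ _ => by positivity) heU).trans (hpot.trans ?_)
    gcongr
  have := Real.log_le_log (by positivity) hmain
  rw [Real.log_pow, Real.log_mul hn.ne' (by positivity), Real.log_pow, Real.log_exp] at this
  linarith

/-! ### Chernoff-type estimates -/

lemma add_sq_div_three_le_one_add_mul_log {ε : ℝ} (h0 : 0 ≤ ε) (h1 : ε ≤ 1) :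
    ε + ε ^ 2 / 3 ≤ (1 + ε) * Real.log (1 + ε) := by
  refine le_trans ?_ (mul_le_mul_of_nonneg_left (Real.le_log_one_add_of_nonneg h0)
    (by linarith))
  rw [mul_div_assoc', le_div_iff₀ (by linarith)]
  nlinarith [mul_nonneg (sq_nonneg ε) (sub_nonneg.2 h1)]

/-- This is `log x ≤ sinh (log x) = (x - x⁻¹) / 2` at `x = (1 - ε)⁻¹`. -/
lemma one_sub_mul_neg_log_le {ε : ℝ} (h0 : 0 ≤ ε) (h1 : ε < 1) :
    (1 - ε) * -Real.log (1 - ε) ≤ ε - ε ^ 2 / 2 := by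
  have hpos : 0 < 1 - ε := by linarith
  have hlog : 0 ≤ -Real.log (1 - ε) :=
    neg_nonneg.2 (Real.log_nonpos hpos.le (by linarith))
  have := Real.self_le_sinh_iff.2 hlog
  rw [← Real.log_inv, Real.sinh_log (inv_pos.2 hpos), inv_inv] at this
  refine (mul_le_mul_of_nonneg_left ((Real.log_inv _).symm.trans_le this) hpos.le).trans_eq ?_
  field_simp
  ring

/-- Solving the upper potential bound for the relative load `b`. Writing `m = max lam g`, the
difference of the two sides is at least `m ((1 + ε) log (1 + ε) - ε - ε² / 3)` plus
`(m - lam) (ε - log (1 + ε))`. -/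
lemma le_add_of_mul_log_one_add_le {ε b lam g : ℝ} (h0 : 0 < ε) (h1 : ε < 1) (hlam : 0 ≤ lam)
    (h : b * Real.log (1 + ε) ≤ ε ^ 2 / 3 * g + ε * lam) : b ≤ lam + ε * max lam g := by
  have hC := add_sq_div_three_le_one_add_mul_log h0.le h1.le
  have hD : 0 < Real.log (1 + ε) := Real.log_pos (by linarith)
  have hD' : Real.log (1 + ε) ≤ ε := by
    linarith [Real.log_le_sub_one_of_pos (x := 1 + ε) (by linarith)]
  refine le_of_mul_le_mul_right (h.trans ?_) hD
  set m := max lam g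
  have hm1 : lam ≤ m := le_max_left _ _
  have hm2 : g ≤ m := le_max_right _ _
  nlinarith [mul_le_mul_of_nonneg_left hm2 (sq_nonneg ε),
    mul_nonneg (sub_nonneg.2 hm1) (sub_nonneg.2 hD'),
    mul_le_mul_of_nonneg_left hC (hlam.trans hm1)]

/-- Solving the lower potential bound for the relative load `b`. -/
lemma sub_le_of_le_mul_neg_log_one_sub {ε b lam g : ℝ} (h0 : 0 < ε) (h1 : ε < 1) (hlam : 0 ≤ lam)
    (h : ε * lam - ε ^ 2 / 3 * g ≤ b * -Real.log (1 - ε)) : lam - ε * max lam g ≤ b := by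
  have hC := one_sub_mul_neg_log_le h0.le h1
  have hD : ε ≤ -Real.log (1 - ε) := by
    linarith [Real.log_le_sub_one_of_pos (x := 1 - ε) (by linarith)]
  refine le_of_mul_le_mul_right (le_trans ?_ h) (h0.trans_le hD)
  set m := max lam g
  have hm1 : lam ≤ m := le_max_left _ _
  have hm2 : g ≤ m := le_max_right _ _
  nlinarith [mul_le_mul_of_nonneg_left hm2 (sq_nonneg ε),
    mul_nonneg (sub_nonneg.2 hm1) (sub_nonneg.2 hD),
    mul_le_mul_of_nonneg_left hC (hlam.trans hm1), mul_nonneg (hlam.trans hm1) (sq_nonneg ε)]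

/-! ### Relative loads against ideal loads -/

lemma packingNumber_pos (M : Matroid α) [M.Finite] : 0 < packingNumber M := by
  obtain ⟨ℓ, hℓ⟩ := exists_isIdealLoad M
  cases hℓ with
  | rank_zero _ _ h0 _ => simp [packingNumber, h0]
  | step _ _ A hA hrk hmin _ _ =>
    have hlt := (eRk_lt_iff_realRk_lt M _ _).1 hrk
    have hc : (0 : ℝ) < A.ncard := by
      exact_mod_cast (Set.ncard_pos (M.ground_finite.subset hA)).2 (nonempty_of_eRk_diff_lt hrk)
    rw [← hmin, packingRatio_eq_ofReal M hA hrk, ENNReal.ofReal_pos]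
    exact div_pos hc (sub_pos.2 hlt)

/-- The two regimes `ℓ e ≥ 1 / γ` and `ℓ e ≤ 1 / γ` in a single bound. -/
lemma IsIdealLoad.abs_relLoad_sub_le {M : Matroid α} [M.Finite] {ℓ : α → ℝ} (hℓ : IsIdealLoad M ℓ)
    {ε γ : ℝ} (hε₀ : 0 < ε) (hε₁ : ε < 1) (hγ : 0 < γ) {B : ℕ → Finset α} {t : ℕ} (ht : 0 < t)
    (hB : IsGreedyBaseCollection M B t)
    (hsize : 3 * γ * Real.log M.E.ncard / ε ^ 2 ≤ t) {e : α} (he : e ∈ M.E) :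
    |relLoad B t e - ℓ e| ≤ ε * max (ℓ e) (1 / γ) := by
  have ht' : (0 : ℝ) < t := by exact_mod_cast ht
  have hlog : Real.log M.E.ncard ≤ ε ^ 2 / 3 * (1 / γ) * t := by
    rw [div_le_iff₀ (by positivity)] at hsize
    have : ε ^ 2 / 3 * (1 / γ) * t = t * ε ^ 2 / (3 * γ) := by field_simp
    rw [this, le_div_iff₀ (by positivity)]
    linarith
  have hload : (load B t e : ℝ) = relLoad B t e * t := by
    rw [relLoad]
    field_simp
  have hup := hℓ.load_mul_log_le hB hε₀ he
  have hlo := hℓ.le_load_mul_neg_log hB hε₀ hε₁ he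
  rw [hload] at hup hlo
  have h1 := le_add_of_mul_log_one_add_le (b := relLoad B t e) (g := 1 / γ) hε₀ hε₁
    (hℓ.nonneg e he) (le_of_mul_le_mul_right (by linarith) ht')
  have h2 := sub_le_of_le_mul_neg_log_one_sub (b := relLoad B t e) (g := 1 / γ) hε₀ hε₁
    (hℓ.nonneg e he) (le_of_mul_le_mul_right (by linarith) ht')
  rw [abs_le]
  constructor <;> linarith

end BaseCollection

theorem mainTheorem4 {α : Type*} (M : Matroid α) [M.Finite]
    (ℓstar : α → ℝ) (hℓstar : BaseCollection.IsIdealLoad M ℓstar)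
    (ε : ℝ) (hε₀ : 0 < ε) (hε₁ : ε < 1)
    (γ : ℝ) (hγΦ : BaseCollection.packingNumber M ≤ ENNReal.ofReal γ)
    (hγβ : ENNReal.ofReal γ ≤ BaseCollection.coveringNumber M)
    (B : ℕ → Finset α) (t : ℕ) (ht : 0 < t)
    (hB : BaseCollection.IsGreedyBaseCollection M B t)
    (hsize : 3 * γ * Real.log (M.E.ncard : ℝ) / ε ^ 2 ≤ (t : ℝ)) :
    (∀ e ∈ M.E, 1 / γ ≤ ℓstar e →
      |BaseCollection.relLoad B t e - ℓstar e| ≤ ε * ℓstar e) ∧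
    (∀ e ∈ M.E, ℓstar e ≤ 1 / γ →
      |BaseCollection.relLoad B t e - ℓstar e| ≤ ε / γ) := by
  have hγ : 0 < γ := ENNReal.ofReal_pos.1 ((BaseCollection.packingNumber_pos M).trans_le hγΦ)
  refine ⟨fun e he h => ?_, fun e he h => ?_⟩
  · simpa only [max_eq_left h] using hℓstar.abs_relLoad_sub_le hε₀ hε₁ hγ ht hB hsize he
  · simpa only [max_eq_right h, mul_one_div] using
      hℓstar.abs_relLoad_sub_le hε₀ hε₁ hγ ht hB hsize he
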